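/- **Setting.** Let $(M,\omega)$ be a finite-dimensional (Hausdorff, paracompact, smooth) symplectic manifold and let $G$ be a Lie group with Lie algebra $\mathfrak g$ acting smoothly on $M$ by symplectomorphisms. For $\xi\in\mathfrak g$ write $\xi$ also for the fundamental vector field $x\mapsto \frac{d}{dt}\big|_{t=0}\exp(-t\xi)x$. For $f\in C^\infty(M)$ let $v_f$ be the vector field with $df=-\iota_{v_f}\omega$ and let $\{f,h\}=\omega(v_f,v_h)$. Let $\mu:M\to\mathfrak g^*$ be a moment map: $\mu$ is smooth and equivariant for the coadjoint action, and $d\mu_\xi=-\iota_\xi\omega$ for all $\xi\in\mathfrak g$, where $\mu_\xi=\langle\mu,\xi\rangle$. Let $N=\mu^{-1}(0)$ and define - $I_N=\{f\in C^\infty(M): f|_N=0\}$, $\;I_\mu$ the ideal of $C^\infty(M)$ generated by the functions $\mu_\xi$, $\xi\in\mathfrak g$; - $F_N=\{f:\{f,I_N\}\subseteq I_N\}$, $\;\mathcal O(N)=\{f:\{f,F_N\cap I_N\}\subseteq I_N\}$, $\;\mathcal Q=\{f:\{f,C^\infty(M)\}\subseteq I_N\}$; - $\mathfrak X_{\mathfrak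 g}(M)$ the $C^\infty(M)$-module generated by the fundamental vector fields, and $I_{\mathfrak X}(N)$ the smooth vector fields $u$ with $u\,C^\infty(M)\subseteq I_N$; - $L_\infty(M,\omega)_{[N]}$, the set of $f\in C^\infty(M)$ such that $\xi f\in I_N$ and $[v_f,\xi]\in\mathfrak X_{\mathfrak g}(M)+I_{\mathfrak X}(N)$ for all $\xi\in\mathfrak g$, and $v_f I_N\subseteq I_N$; - $I_{L_\infty}(N)$, the set of $f\in L_\infty(M,\omega)_{[N]}$ with $f\in I_N$ and $v_f\in\mathfrak X_{\mathfrak g}(M)+I_{\mathfrak X}(N)$. The set $N$ is *first class* if it is closed and $I_N\subseteq F_N$. **Proposition.** Assume that $N=\mu^{-1}(0)$ is first class. Then $L_\infty(M,\omega)_{[N]}$ and $\mathcal O(N)$ are Poisson subalgebras of $C^\infty(M)$, $\mathcal O(N)=F_N$, and $I_{L_\infty}(N)$ and $I_N$ are Poisson ideals of them respectively, so that the $L_\infty$-reduction $L_\infty(M,\omega)_{[N]}/I_{L_\infty}(N)$ and the Dirac reduction $\mathcal O(N)/I_N=F_N/I_N$ are Poisson algebras. Moreover $L_\infty(M,\omega)_{[N]}\subseteq\mathcal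 O(N)$, and the identity on representatives, $[f]\mapsto[f]$, is a well-defined homomorphism of Poisson algebras $$\Phi:\;L_\infty(M,\omega)_{[N]}/I_{L_\infty}(N)\longrightarrow \mathcal O(N)/I_N=F_N/I_N .$$ If moreover $I_N=I_\mu+I_N\cap\mathcal Q$, then the two reductions coincide: $L_\infty(M,\omega)_{[N]}=\mathcal O(N)$, $I_{L_\infty}(N)=I_N$, and $\Phi$ is bijective. -/

import Mathlib

open scoped Manifold ContDiff Pointwise
open Bundle VectorField

noncomputable section

/-! ### Poisson algebras, Poisson subquotients -/

/-- A Poisson bracket on a commutative `ℝ`-algebra: a Lie bracket that is a derivation in each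
argument. -/
structure PoissonBracket (A : Type*) [CommRing A] [Algebra ℝ A] where
  bracket : A →ₗ[ℝ] A →ₗ[ℝ] A
  bracket_self : ∀ a, bracket a a = 0
  jacobi : ∀ a b c, bracket a (bracket b c) = bracket (bracket a b) c + bracket b (bracket a c)
  leibniz : ∀ a b c, bracket a (b * c) = bracket a b * c + b * bracket a c

/-- A Poisson subalgebra of a Poisson algebra together with a Poisson ideal of that subalgebra. -/
structure PoissonSubquotient {A : Type*} [CommRing A] [Algebra ℝ A] (P : PoissonBracket A) where
  subalgebra : Subalgebra ℝ A
  bracket_mem : ∀ a b : subalgebra, P.bracket a b ∈ subalgebra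
  ideal : Ideal subalgebra
  bracket_mem_ideal : ∀ (a b : subalgebra), b ∈ ideal →
    (⟨P.bracket a b, bracket_mem a b⟩ : subalgebra) ∈ ideal

namespace PoissonSubquotient

variable {A : Type*} [CommRing A] [Algebra ℝ A] {P : PoissonBracket A}
  (S : PoissonSubquotient P)

/-- The quotient of the subalgebra by the ideal. -/
abbrev Quot : Type _ := S.subalgebra ⧸ S.ideal

/-- The class in the quotient of an element of the subalgebra. -/
abbrev cls (a : S.subalgebra) : S.Quot := Ideal.Quotient.mk S.ideal a

/-- The bracket of `P` restricted to the subalgebra. -/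
def subBracket : S.subalgebra →ₗ[ℝ] S.subalgebra →ₗ[ℝ] S.subalgebra :=
  LinearMap.mk₂ ℝ (fun a b => ⟨P.bracket a b, S.bracket_mem a b⟩)
    (fun a b c => Subtype.ext (by simp)) (fun r a b => Subtype.ext (by simp))
    (fun a b c => Subtype.ext (by simp)) (fun r a b => Subtype.ext (by simp))

theorem subBracket_swap (a b : S.subalgebra) : S.subBracket a b = - S.subBracket b a := by
  have h := P.bracket_self ((a : A) + b)
  simp only [map_add, LinearMap.add_apply, P.bracket_self, zero_add, add_zero] at h
  exact Subtype.ext (by simpa [subBracket] using eq_neg_of_add_eq_zero_right h)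

theorem cls_subBracket_congr {a a' b b' : S.subalgebra} (ha : S.cls a = S.cls a')
    (hb : S.cls b = S.cls b') : S.cls (S.subBracket a b) = S.cls (S.subBracket a' b') := by
  rw [Ideal.Quotient.eq] at ha hb ⊢
  have h : S.subBracket a b - S.subBracket a' b' =
      S.subBracket a (b - b') - S.subBracket b' (a - a') := by
    rw [map_sub, map_sub, S.subBracket_swap b' a, S.subBracket_swap b' a']; ring
  rw [h]
  exact S.ideal.sub_mem (S.bracket_mem_ideal a _ hb) (S.bracket_mem_ideal b' _ ha)

/-- The Poisson bracket `{[a], [b]} = [{a, b}]` on the quotient. -/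
def quotBracket : PoissonBracket S.Quot where
  bracket := LinearMap.mk₂ ℝ
    (fun x y => Quotient.liftOn₂' x y (fun a b => S.cls (S.subBracket a b))
      (fun a b a' b' ha hb => S.cls_subBracket_congr
        (Quotient.sound' ha) (Quotient.sound' hb)))
    (by rintro ⟨a⟩ ⟨b⟩ ⟨c⟩; exact congrArg S.cls (by simp : S.subBracket (a + b) c = _))
    (by rintro r ⟨a⟩ ⟨b⟩; exact congrArg S.cls (by simp : S.subBracket (r • a) b = _))
    (by rintro ⟨a⟩ ⟨b⟩ ⟨c⟩; exact congrArg S.cls (by simp : S.subBracket a (b + c) = _))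
    (by rintro r ⟨a⟩ ⟨b⟩; exact congrArg S.cls (by simp : S.subBracket a (r • b) = _))
  bracket_self := by
    rintro ⟨a⟩
    exact congrArg S.cls (Subtype.ext (P.bracket_self a) : S.subBracket a a = 0)
  jacobi := by
    rintro ⟨a⟩ ⟨b⟩ ⟨c⟩
    exact congrArg S.cls (Subtype.ext (P.jacobi a b c) : S.subBracket a (S.subBracket b c) =
      S.subBracket (S.subBracket a b) c + S.subBracket b (S.subBracket a c))
  leibniz := by
    rintro ⟨a⟩ ⟨b⟩ ⟨c⟩
    exact congrArg S.cls (Subtype.ext (P.leibniz a b c) : S.subBracket a (b * c) =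
      S.subBracket a b * c + b * S.subBracket a c)

theorem quotBracket_cls (a b : S.subalgebra) :
    S.quotBracket.bracket (S.cls a) (S.cls b) = S.cls ⟨P.bracket a b, S.bracket_mem a b⟩ := rfl

end PoissonSubquotient

/-- A morphism of Poisson algebras: a unital algebra homomorphism preserving the brackets. -/
structure PoissonHom {A B : Type*} [CommRing A] [Algebra ℝ A] [CommRing B] [Algebra ℝ B]
    (P : PoissonBracket A) (Q : PoissonBracket B) extends A →ₐ[ℝ] B where
  map_bracket : ∀ a b, toFun (P.bracket a b) = Q.bracket (toFun a) (toFun b)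

/-! ### Functions, vector fields and symplectic forms -/

section Manifold

variable {E : Type*} [NormedAddCommGroup E] [NormedSpace ℝ E]
  {M : Type*} [TopologicalSpace M] [ChartedSpace E M]

variable (E M) in
/-- The algebra `C^∞(M)`. -/
abbrev SmoothFun : Type _ := C^∞⟮𝓘(ℝ, E), M; ℝ⟯

variable (E M) in
/-- (Not necessarily smooth) vector fields on `M`. -/
abbrev VField : Type _ := (x : M) → TangentSpace 𝓘(ℝ, E) x

/-- Smoothness of a vector field, as a section of the tangent bundle. -/
def VField.IsSmooth [IsManifold 𝓘(ℝ, E) ∞ M] (u : VField E M) : Prop :=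
  ContMDiff 𝓘(ℝ, E) 𝓘(ℝ, E).tangent ∞ (fun x => (⟨x, u x⟩ : TangentBundle 𝓘(ℝ, E) M))

/-- The derivative `u f` of a function `f` along a vector field `u`. -/
def VField.deriv (u : VField E M) (f : M → ℝ) (x : M) : ℝ :=
  mvfderiv 𝓘(ℝ, E) f x (u x)

variable (E M) in
/-- A symplectic form on `M`: a smooth, alternating, nondegenerate, closed 2-form.
Closedness is `dΩ(u, v, w) = 0` for all smooth vector fields, `dΩ` being given by the invariant
formula for the exterior derivative. -/
structure SymplecticForm [IsManifold 𝓘(ℝ, E) ∞ M] where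
  toFun : (x : M) → TangentSpace 𝓘(ℝ, E) x →L[ℝ] TangentSpace 𝓘(ℝ, E) x →L[ℝ] ℝ
  smooth : ContMDiff 𝓘(ℝ, E) (𝓘(ℝ, E).prod 𝓘(ℝ, E →L[ℝ] E →L[ℝ] ℝ)) ∞
    (fun x => TotalSpace.mk' (E →L[ℝ] E →L[ℝ] ℝ)
      (E := fun x : M => TangentSpace 𝓘(ℝ, E) x →L[ℝ] TangentSpace 𝓘(ℝ, E) x →L[ℝ] ℝ) x (toFun x))
  alternating : ∀ x v, toFun x v v = 0
  nondegenerate : ∀ x v, (∀ w, toFun x v w = 0) → v = 0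
  closed : ∀ u v w : VField E M, u.IsSmooth → v.IsSmooth → w.IsSmooth → ∀ x,
    u.deriv (fun y => toFun y (v y) (w y)) x
      - v.deriv (fun y => toFun y (u y) (w y)) x
      + w.deriv (fun y => toFun y (u y) (v y)) x
      - toFun x (mlieBracket 𝓘(ℝ, E) u v x) (w x)
      + toFun x (mlieBracket 𝓘(ℝ, E) u w x) (v x)
      - toFun x (mlieBracket 𝓘(ℝ, E) v w x) (u x) = 0

namespace SymplecticForm

variable [IsManifold 𝓘(ℝ, E) ∞ M] (Ω : SymplecticForm E M)

/-- The Hamiltonian vector field `v_f`, determined by `df = - ι_{v_f} Ω`. -/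
def hamVF (f : SmoothFun E M) : VField E M := fun x =>
  - (Ω.toFun x).inverse (mvfderiv 𝓘(ℝ, E) f x)

/-- The function `{f, h} = Ω(v_f, v_h)`. -/
def poisson (f h : SmoothFun E M) (x : M) : ℝ :=
  Ω.toFun x (Ω.hamVF f x) (Ω.hamVF h x)

theorem isInvertible_aux {V : Type*} [NormedAddCommGroup V] [NormedSpace ℝ V]
    [FiniteDimensional ℝ V] (B : V →L[ℝ] V →L[ℝ] ℝ) (hB : ∀ v, (∀ w, B v w = 0) → v = 0) :
    B.IsInvertible := by
  have hinj : Function.Injective B.toLinearMap := by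
    rw [← LinearMap.ker_eq_bot, LinearMap.ker_eq_bot']
    exact fun v hv => hB v fun w => DFunLike.congr_fun hv w
  have hfin : Module.finrank ℝ V = Module.finrank ℝ (V →L[ℝ] ℝ) :=
    Subspace.dual_finrank_eq.symm.trans
      (LinearMap.toContinuousLinearMap (𝕜 := ℝ) (E := V) (F' := ℝ)).finrank_eq
  exact ⟨(LinearMap.linearEquivOfInjective B.toLinearMap hinj hfin).toContinuousLinearEquiv, rfl⟩

theorem smooth_deriv_at {f : M → ℝ} {s : VField E M} {x : M}
    (hf : ContMDiff 𝓘(ℝ, E) 𝓘(ℝ, ℝ) ∞ f)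
    (hs : ContMDiffAt 𝓘(ℝ, E) 𝓘(ℝ, E).tangent ∞
      (fun x => (⟨x, s x⟩ : TangentBundle 𝓘(ℝ, E) M)) x) :
    ContMDiffAt 𝓘(ℝ, E) 𝓘(ℝ, ℝ) ∞ (s.deriv f) x := by
  have h1 : ContMDiff 𝓘(ℝ, E).tangent 𝓘(ℝ, ℝ).tangent ∞ (tangentMap 𝓘(ℝ, E) 𝓘(ℝ, ℝ) f) :=
    hf.contMDiff_tangentMap (by simp)
  have h2 := (contMDiff_snd_tangentBundle_modelSpace ℝ 𝓘(ℝ, ℝ) (n := ∞)).comp h1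
  exact (h2 _).comp x hs

theorem smooth_pairing_at {s t : VField E M} {x : M}
    (hs : ContMDiffAt 𝓘(ℝ, E) 𝓘(ℝ, E).tangent ∞
      (fun x => (⟨x, s x⟩ : TangentBundle 𝓘(ℝ, E) M)) x)
    (ht : ContMDiffAt 𝓘(ℝ, E) 𝓘(ℝ, E).tangent ∞
      (fun x => (⟨x, t x⟩ : TangentBundle 𝓘(ℝ, E) M)) x) :
    ContMDiffAt 𝓘(ℝ, E) 𝓘(ℝ, ℝ) ∞ (fun x => Ω.toFun x (s x) (t x)) x := by
  have : ContMDiffAt 𝓘(ℝ, E) (𝓘(ℝ, E).prod 𝓘(ℝ, ℝ)) ∞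
      (fun m ↦ TotalSpace.mk' ℝ (E := Bundle.Trivial M ℝ) m (Ω.toFun m (s m) (t m))) x :=
    ContMDiffAt.clm_bundle_apply₂ (F₁ := E) (F₂ := E) (Ω.smooth x) hs ht
  simp only [contMDiffAt_totalSpace] at this
  exact this.2

theorem toFun_swap (x : M) (v w : TangentSpace 𝓘(ℝ, E) x) :
    Ω.toFun x v w = - Ω.toFun x w v := by
  have := Ω.alternating x (v + w)
  simp only [map_add, add_apply, Ω.alternating] at this
  linarith

theorem poisson_swap (f h : SmoothFun E M) (x : M) : Ω.poisson f h x = - Ω.poisson h f x :=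
  Ω.toFun_swap x _ _

variable [FiniteDimensional ℝ E]

theorem isInvertible (x : M) : (Ω.toFun x).IsInvertible := 
  isInvertible_aux (V := E) (Ω.toFun x) (Ω.nondegenerate x)

theorem mvfderiv_eq_neg_hamVF (f : SmoothFun E M) (x : M) (w : TangentSpace 𝓘(ℝ, E) x) :
    mvfderiv 𝓘(ℝ, E) f x w = - Ω.toFun x (Ω.hamVF f x) w := by
  rw [hamVF, map_neg, neg_apply, neg_neg, (Ω.isInvertible x).self_apply_inverse]

theorem hamVF_eq {f : SmoothFun E M} {x : M} {v : TangentSpace 𝓘(ℝ, E) x}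
    (h : ∀ w, mvfderiv 𝓘(ℝ, E) f x w = - Ω.toFun x v w) : Ω.hamVF f x = v := by
  refine sub_eq_zero.1 (Ω.nondegenerate x _ fun w => ?_)
  rw [map_sub, sub_apply]
  linarith [h w, Ω.mvfderiv_eq_neg_hamVF f x w]

theorem hamVF_isSmooth (f : SmoothFun E M) : (Ω.hamVF f).IsSmooth := by
  intro x₀
  let b := Module.finBasis ℝ E
  let e := trivializationAt E (TangentSpace 𝓘(ℝ, E)) x₀
  have hx₀ : x₀ ∈ e.baseSet := FiberBundle.mem_baseSet_trivializationAt' x₀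
  let s : Fin _ → VField E M := e.localFrame b
  have hs : ∀ i, ContMDiffAt 𝓘(ℝ, E) 𝓘(ℝ, E).tangent ∞
      (fun x => (⟨x, s i x⟩ : TangentBundle 𝓘(ℝ, E) M)) x₀ :=
    fun i => contMDiffAt_localFrame_of_mem ∞ e b i hx₀
  let A : M → E →L[ℝ] E →L[ℝ] ℝ := fun x => ∑ i, ∑ j, Ω.toFun x (s i x) (s j x) •
    ((b.coord i).toContinuousLinearMap.smulRight (b.coord j).toContinuousLinearMap)
  let D : M → E →L[ℝ] ℝ := fun x => ∑ j, (s j).deriv f x • (b.coord j).toContinuousLinearMap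
  have hA : ContMDiffAt 𝓘(ℝ, E) 𝓘(ℝ, E →L[ℝ] E →L[ℝ] ℝ) ∞ A x₀ :=
    ContMDiffAt.sum fun i _ => ContMDiffAt.sum fun j _ =>
      ContMDiffAt.smul (Ω.smooth_pairing_at (hs i) (hs j)) contMDiffAt_const
  have hD : ContMDiffAt 𝓘(ℝ, E) 𝓘(ℝ, E →L[ℝ] ℝ) ∞ D x₀ :=
    ContMDiffAt.sum fun j _ =>
      ContMDiffAt.smul (smooth_deriv_at f.contMDiff (hs j)) contMDiffAt_const
  have hframe : ∀ x ∈ e.baseSet, ∀ a : E, e.symmL ℝ x a = ∑ i, b.coord i a • s i x := by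
    intro x hx a
    conv_lhs => rw [← b.sum_repr a]
    rw [map_sum]
    refine Finset.sum_congr rfl fun i _ => ?_
    rw [map_smul]
    congr 1
    simp [s, hx, Trivialization.basisAt]
  have hAx : ∀ x ∈ e.baseSet, ∀ a c : E,
      A x a c = Ω.toFun x (e.symmL ℝ x a) (e.symmL ℝ x c) := by
    intro x hx a c
    rw [hframe x hx, hframe x hx]
    simp only [A, map_sum, map_smul, sum_apply, smul_apply, ContinuousLinearMap.smulRight_apply,
      smul_eq_mul, LinearMap.coe_toContinuousLinearMap', Finset.mul_sum]
    rw [Finset.sum_comm]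
    refine Finset.sum_congr rfl fun i _ => Finset.sum_congr rfl fun j _ => by ring
  have hDx : ∀ x ∈ e.baseSet, ∀ c : E, D x c = mvfderiv 𝓘(ℝ, E) f x (e.symmL ℝ x c) := by
    intro x hx c
    rw [hframe x hx]
    simp [D, VField.deriv, mul_comm]
  have hw : ∀ x ∈ e.baseSet, ∀ w : TangentSpace 𝓘(ℝ, E) x,
      e.symmL ℝ x (e.continuousLinearMapAt ℝ x w) = w :=
    fun x hx w => e.symmL_continuousLinearMapAt hx w
  have hAinv : ∀ x ∈ e.baseSet, (A x).IsInvertible := by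
    intro x hx
    refine isInvertible_aux _ fun a ha => ?_
    have h0 : e.symmL ℝ x a = 0 := Ω.nondegenerate x _ fun w => by
      rw [← hw x hx w, ← hAx x hx]
      exact ha _
    rw [← e.continuousLinearMapAt_symmL (R := ℝ) hx a, h0, map_zero]
  have hv : ContMDiffAt 𝓘(ℝ, E) 𝓘(ℝ, E) ∞ (fun x => - (A x).inverse (D x)) x₀ := by
    refine ContMDiffAt.neg (ContMDiffAt.clm_apply ?_ hD)
    exact ((hAinv x₀ hx₀).contDiffAt_map_inverse (n := ∞)).contMDiffAt.comp x₀ hA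
  have hsum : ContMDiffAt 𝓘(ℝ, E) 𝓘(ℝ, E).tangent ∞
      (fun x => (⟨x, ∑ i, (b.coord i (- (A x).inverse (D x))) • s i x⟩ :
        TangentBundle 𝓘(ℝ, E) M)) x₀ := by
    refine ContMDiffAt.sum_section fun i _ => ContMDiffAt.smul_section ?_ (hs i)
    exact (b.coord i).toContinuousLinearMap.contDiff.contMDiff.contMDiffAt.comp x₀ hv
  refine hsum.congr_of_eventuallyEq ?_
  filter_upwards [e.open_baseSet.mem_nhds hx₀] with x hx
  have : Ω.hamVF f x = ∑ i, (b.coord i (- (A x).inverse (D x))) • s i x := by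
    rw [← hframe x hx]
    refine Ω.hamVF_eq fun w => ?_
    rw [← hw x hx w, ← hDx x hx, ← hAx x hx, map_neg, neg_apply, neg_neg,
      (hAinv x hx).self_apply_inverse]
  rw [this]

/-- Lie brackets of vector fields act on functions as commutators. -/
theorem mlieBracket_deriv {u v : VField E M} (hu : u.IsSmooth) (hv : v.IsSmooth) {f : M → ℝ}
    (hf : ContMDiff 𝓘(ℝ, E) 𝓘(ℝ, ℝ) ∞ f) (x : M) :
    VField.deriv (mlieBracket 𝓘(ℝ, E) u v) f x =
      u.deriv (v.deriv f) x - v.deriv (u.deriv f) x := by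
  have : CompleteSpace E := FiniteDimensional.complete ℝ E
  have : IsManifold 𝓘(ℝ, E) (minSmoothness ℝ 3) M := by
    simp only [minSmoothness_of_isRCLikeNormedField]; infer_instance
  have : IsManifold 𝓘(ℝ, E) 2 M := inferInstance
  have : IsManifold 𝓘(ℝ, E) (((⊤ : ℕ∞) : ℕ∞ω) + 1) M := ‹IsManifold 𝓘(ℝ, E) ∞ M›
  rcases subsingleton_or_nontrivial E with hE | hE
  · have h0 : ∀ (w : VField E M) (g : M → ℝ) , w.deriv g x = 0 := fun w g => by
      have : w x = 0 := @Subsingleton.elim E hE _ _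
      rw [VField.deriv, this, map_zero]
    simp [h0]
  let b := Module.finBasis ℝ E
  let e := trivializationAt E (TangentSpace 𝓘(ℝ, E)) x
  have hx : x ∈ e.baseSet := FiberBundle.mem_baseSet_trivializationAt' x
  obtain ⟨i⟩ : Nonempty (Fin (Module.finrank ℝ E)) := b.index_nonempty
  let z : VField E M := e.localFrame b i
  have hz : ∀ y ∈ e.baseSet, ContMDiffAt 𝓘(ℝ, E) 𝓘(ℝ, E).tangent ∞
      (fun x => (⟨x, z x⟩ : TangentBundle 𝓘(ℝ, E) M)) y :=
    fun y hy => contMDiffAt_localFrame_of_mem ∞ e b i hy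
  have hzx : z x ≠ 0 := by
    simp only [z, e.localFrame_apply_of_mem_baseSet b hx]
    exact (e.basisAt b hx).ne_zero i
  have hz' := hz x hx
  have huf : ∀ y, ContMDiffAt 𝓘(ℝ, E) 𝓘(ℝ, ℝ) ∞ (u.deriv f) y := fun y => smooth_deriv_at hf (hu y)
  have hvf : ∀ y, ContMDiffAt 𝓘(ℝ, E) 𝓘(ℝ, ℝ) ∞ (v.deriv f) y := fun y => smooth_deriv_at hf (hv y)
  have hfz : ContMDiffAt 𝓘(ℝ, E) 𝓘(ℝ, E).tangent ∞
      (fun x => (⟨x, (f • z) x⟩ : TangentBundle 𝓘(ℝ, E) M)) x := (hf x).smul_section hz'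
  have hbr : ∀ w : VField E M, w.IsSmooth → ContMDiffAt 𝓘(ℝ, E) 𝓘(ℝ, E).tangent ∞
      (fun x => (⟨x, mlieBracket 𝓘(ℝ, E) w z x⟩ : TangentBundle 𝓘(ℝ, E) M)) x := fun w hw =>
    ContMDiffAt.mlieBracket_vectorField (m := ⊤) (n := ⊤) (hw x) hz' (by simp)
  have top2 : minSmoothness ℝ 2 ≤ (∞ : ℕ∞ω) := by
    rw [minSmoothness_of_isRCLikeNormedField]; exact WithTop.coe_le_coe.2 (le_top : (2 : ℕ∞) ≤ ⊤)
  have tn : (∞ : ℕ∞ω) ≠ 0 := by simp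
  have exp : ∀ w : VField E M, w.IsSmooth → mlieBracket 𝓘(ℝ, E) w (f • z) =ᶠ[nhds x]
      (w.deriv f • z + f • mlieBracket 𝓘(ℝ, E) w z) := by
    intro w hw
    filter_upwards [e.open_baseSet.mem_nhds hx] with y hy
    exact mlieBracket_smul_right ((hf y).mdifferentiableAt tn) ((hz y hy).mdifferentiableAt tn)
  have exp2 : ∀ w w' : VField E M, w.IsSmooth → w'.IsSmooth →
      mlieBracket 𝓘(ℝ, E) w' (mlieBracket 𝓘(ℝ, E) w (f • z)) x =
        (w'.deriv (w.deriv f) x • z x + w.deriv f x • mlieBracket 𝓘(ℝ, E) w' z x) +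
        (w'.deriv f x • mlieBracket 𝓘(ℝ, E) w z x +
          f x • mlieBracket 𝓘(ℝ, E) w' (mlieBracket 𝓘(ℝ, E) w z) x) := by
    intro w w' hw hw'
    have hwf : ContMDiffAt 𝓘(ℝ, E) 𝓘(ℝ, ℝ) ∞ (w.deriv f) x := smooth_deriv_at hf (hw x)
    rw [Filter.EventuallyEq.mlieBracket_vectorField_eq (Filter.EventuallyEq.refl _ w') (exp w hw),
      mlieBracket_add_right ((hwf.smul_section hz').mdifferentiableAt tn)
        (((hf x).smul_section (hbr w hw)).mdifferentiableAt tn),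
      mlieBracket_smul_right (hwf.mdifferentiableAt tn) (hz'.mdifferentiableAt tn),
      mlieBracket_smul_right ((hf x).mdifferentiableAt tn) ((hbr w hw).mdifferentiableAt tn)]
    rfl
  have hL := leibniz_identity_mlieBracket_apply ((hu x).of_le top2) ((hv x).of_le top2)
    (hfz.of_le top2)
  have hL0 := leibniz_identity_mlieBracket_apply ((hu x).of_le top2) ((hv x).of_le top2)
    (hz'.of_le top2)
  rw [exp2 v u hv hu, exp2 u v hu hv, mlieBracket_smul_right ((hf x).mdifferentiableAt tn)
    (hz'.mdifferentiableAt tn), hL0] at hL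
  have key : (VField.deriv (mlieBracket 𝓘(ℝ, E) u v) f x -
      (u.deriv (v.deriv f) x - v.deriv (u.deriv f) x)) • z x = 0 := by
    change _ = (VField.deriv (mlieBracket 𝓘(ℝ, E) u v) f x • z x + _) + _ at hL
    rw [sub_smul, sub_smul]
    rw [← sub_eq_zero] at hL
    rw [← neg_eq_zero, ← hL]
    module
  exact sub_eq_zero.1 ((smul_eq_zero.1 key).resolve_right hzx)

theorem poisson_eq_deriv (f h : SmoothFun E M) :
    Ω.poisson f h = (Ω.hamVF f).deriv h := by
  ext x
  rw [VField.deriv, Ω.mvfderiv_eq_neg_hamVF, poisson, Ω.toFun_swap]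

theorem poisson_smooth (f h : SmoothFun E M) :
    ContMDiff 𝓘(ℝ, E) 𝓘(ℝ, ℝ) ∞ (Ω.poisson f h) :=
  fun x => Ω.smooth_pairing_at (Ω.hamVF_isSmooth f x) (Ω.hamVF_isSmooth h x)

theorem poisson_add (f g h : SmoothFun E M) (x : M) :
    Ω.poisson f (g + h) x = Ω.poisson f g x + Ω.poisson f h x := by
  simp only [poisson_eq_deriv, VField.deriv, ContMDiffMap.coe_add]
  rw [mvfderiv_add (g.contMDiff.mdifferentiableAt (by simp))
    (h.contMDiff.mdifferentiableAt (by simp)), add_apply]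

theorem poisson_mul (f g h : SmoothFun E M) (x : M) :
    Ω.poisson f (g * h) x = Ω.poisson f g x * h x + g x * Ω.poisson f h x := by
  simp only [poisson_eq_deriv, VField.deriv, ContMDiffMap.coe_mul]
  rw [mvfderiv_mul (g.contMDiff.mdifferentiableAt (by simp))
    (h.contMDiff.mdifferentiableAt (by simp)), add_apply, smul_apply, smul_apply]
  simp only [smul_eq_mul]
  ring

theorem poisson_smul (r : ℝ) (f h : SmoothFun E M) (x : M) :
    Ω.poisson f (r • h) x = r * Ω.poisson f h x := by
  have h0 : Ω.poisson f (algebraMap ℝ (SmoothFun E M) r) x = 0 := by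
    simp only [poisson_eq_deriv, VField.deriv]
    have : ⇑(algebraMap ℝ (SmoothFun E M) r) = fun _ => r := rfl
    rw [this, mvfderiv_const, zero_apply]
  rw [Algebra.smul_def, poisson_mul, h0, zero_mul, zero_add]
  rfl

/-- The function `{f, h}` as an element of `C^∞(M)`. -/
def poissonFun (f h : SmoothFun E M) : SmoothFun E M := ⟨Ω.poisson f h, Ω.poisson_smooth f h⟩

theorem poisson_jacobi (f g h : SmoothFun E M) (x : M) :
    Ω.poisson f (Ω.poissonFun g h) x =
      Ω.poisson (Ω.poissonFun f g) h x + Ω.poisson g (Ω.poissonFun f h) x := by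
  have hc := Ω.closed _ _ _ (Ω.hamVF_isSmooth f) (Ω.hamVF_isSmooth g) (Ω.hamVF_isSmooth h) x
  have dp : ∀ a b c : SmoothFun E M, (Ω.hamVF a).deriv (Ω.poisson b c) x =
      Ω.poisson a (Ω.poissonFun b c) x := fun a b c =>
    (congrFun (Ω.poisson_eq_deriv a (Ω.poissonFun b c)) x).symm
  have key : ∀ a b c : SmoothFun E M,
      Ω.toFun x (mlieBracket 𝓘(ℝ, E) (Ω.hamVF a) (Ω.hamVF b) x) (Ω.hamVF c x) =
        Ω.poisson a (Ω.poissonFun b c) x - Ω.poisson b (Ω.poissonFun a c) x := by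
    intro a b c
    rw [Ω.toFun_swap, ← Ω.mvfderiv_eq_neg_hamVF, ← dp, ← dp, poisson_eq_deriv, poisson_eq_deriv]
    exact mlieBracket_deriv (Ω.hamVF_isSmooth a) (Ω.hamVF_isSmooth b) c.contMDiff x
  have sw : ∀ a b c : SmoothFun E M, Ω.poisson a (Ω.poissonFun b c) x =
      - Ω.poisson a (Ω.poissonFun c b) x := by
    intro a b c
    have : Ω.poisson b c = - Ω.poisson c b := funext fun y => Ω.poisson_swap b c y
    rw [← dp, ← dp, this, VField.deriv, VField.deriv, mvfderiv_neg, neg_apply]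
  have hc1 : (Ω.hamVF f).deriv (Ω.poisson g h) x - (Ω.hamVF g).deriv (Ω.poisson f h) x
      + (Ω.hamVF h).deriv (Ω.poisson f g) x
      - Ω.toFun x (mlieBracket 𝓘(ℝ, E) (Ω.hamVF f) (Ω.hamVF g) x) (Ω.hamVF h x)
      + Ω.toFun x (mlieBracket 𝓘(ℝ, E) (Ω.hamVF f) (Ω.hamVF h) x) (Ω.hamVF g x)
      - Ω.toFun x (mlieBracket 𝓘(ℝ, E) (Ω.hamVF g) (Ω.hamVF h) x) (Ω.hamVF f x) = 0 := hc
  rw [dp, dp, dp, key, key, key, sw f h g, sw g h f, sw h g f] at hc1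
  rw [Ω.poisson_swap _ h]
  linarith

/-- The Poisson algebra `C^∞(M, Ω)`, with `{f, h} = Ω(v_f, v_h)`. -/
def poissonBracket : PoissonBracket (SmoothFun E M) where
  bracket := LinearMap.mk₂ ℝ Ω.poissonFun
    (fun f g h => by
      ext x
      change Ω.poisson (f + g) h x = Ω.poisson f h x + Ω.poisson g h x
      rw [Ω.poisson_swap, Ω.poisson_add, Ω.poisson_swap f, Ω.poisson_swap g]; ring)
    (fun r f h => by
      ext x
      change Ω.poisson (r • f) h x = r * Ω.poisson f h x
      rw [Ω.poisson_swap, Ω.poisson_smul, Ω.poisson_swap f]; ring)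
    (fun f g h => by ext x; exact Ω.poisson_add f g h x)
    (fun r f h => by ext x; exact Ω.poisson_smul r f h x)
  bracket_self f := by ext x; exact Ω.alternating x _
  jacobi f g h := by ext x; exact Ω.poisson_jacobi f g h x
  leibniz f g h := by ext x; exact Ω.poisson_mul f g h x

theorem poissonBracket_apply (f h : SmoothFun E M) (x : M) :
    Ω.poissonBracket.bracket f h x = Ω.toFun x (Ω.hamVF f x) (Ω.hamVF h x) := rfl

end SymplecticForm

/-! ### Constraint sets and Dirac reduction -/

/-- The ideal `I_N` of smooth functions vanishing on `N`. -/
def constraintIdeal (N : Set M) : Ideal (SmoothFun E M) where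
  carrier := {f | ∀ x ∈ N, f x = 0}
  add_mem' {f g} hf hg x hx := by simp [hf x hx, hg x hx]
  zero_mem' x _ := rfl
  smul_mem' c f hf x hx := by simp [hf x hx]

section Dirac

variable [IsManifold 𝓘(ℝ, E) ∞ M] (Ω : SymplecticForm E M) (N : Set M)

/-- First class functions: `F_N = {f | {f, I_N} ⊆ I_N}`. -/
def firstClassFunctions : Set (SmoothFun E M) :=
  {f | ∀ h ∈ constraintIdeal (E := E) N, ∀ x ∈ N, Ω.poisson f h x = 0}

/-- First class sets: closed sets `N` with `I_N ⊆ F_N`. -/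
def IsFirstClass : Prop :=
  IsClosed N ∧ (constraintIdeal (E := E) N : Set (SmoothFun E M)) ⊆ firstClassFunctions Ω N

/-- Dirac observables: `O(N) = {f | {f, F_N ∩ I_N} ⊆ I_N}`. -/
def diracObservables : Set (SmoothFun E M) :=
  {f | ∀ h ∈ firstClassFunctions Ω N, h ∈ constraintIdeal (E := E) N →
    ∀ x ∈ N, Ω.poisson f h x = 0}

/-- Casimir functions along `N`: `Q = {f | {f, C^∞(M)} ⊆ I_N}`. -/
def casimirFunctions : Set (SmoothFun E M) :=
  {f | ∀ h : SmoothFun E M, ∀ x ∈ N, Ω.poisson f h x = 0}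

end Dirac

/-! ### Vector fields along a constraint set -/

section Fields

variable [IsManifold 𝓘(ℝ, E) ∞ M] (N : Set M)

/-- Vector fields tangent to `N`: `u I_N ⊆ I_N`. -/
def tangentFields : Set (VField E M) :=
  {u | u.IsSmooth ∧ ∀ f ∈ constraintIdeal (E := E) N, ∀ x ∈ N, u.deriv f x = 0}

/-- Vector fields vanishing along `N`: `u C^∞(M) ⊆ I_N`. -/
def vanishingFields : Set (VField E M) :=
  {u | u.IsSmooth ∧ ∀ f : SmoothFun E M, ∀ x ∈ N, u.deriv f x = 0}

end Fields

/-! ### Hamiltonian actions -/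

section Action

variable {𝔼 : Type*} [NormedAddCommGroup 𝔼] [NormedSpace ℝ 𝔼]
  {G : Type*} [TopologicalSpace G] [ChartedSpace 𝔼 G] [Group G]

variable (𝔼 G) in
/-- The Lie algebra of `G`. -/
abbrev LieAlg : Type _ := GroupLieAlgebra 𝓘(ℝ, 𝔼) G

/-- The adjoint action of `G` on its Lie algebra: the derivative at `1` of conjugation. -/
def Ad (g : G) : LieAlg 𝔼 G → LieAlg 𝔼 G := fun ξ =>
  mfderiv 𝓘(ℝ, 𝔼) 𝓘(ℝ, 𝔼) (fun h : G => g * h * g⁻¹) 1 ξ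

variable [MulAction G M]

/-- The fundamental vector field of `ξ`: at `x` it is the velocity at `t = 0` of
`t ↦ exp (-t ξ) • x`, that is, the derivative at `1` of the orbit map `g ↦ g • x` applied to
`-ξ`. -/
def fundamentalField (ξ : LieAlg 𝔼 G) : VField E M := fun x =>
  mfderiv 𝓘(ℝ, 𝔼) 𝓘(ℝ, E) (fun g : G => g • x) 1 (-ξ)

variable (E M 𝔼 G) in
/-- The `C^∞(M)`-module of vector fields generated by the fundamental vector fields. -/
def fundamentalFields : Set (VField E M) :=
  {u | ∃ (n : ℕ) (a : Fin n → SmoothFun E M) (ξ : Fin n → LieAlg 𝔼 G),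
    ∀ x, u x = ∑ i, a i x • fundamentalField (ξ i) x}

variable [IsManifold 𝓘(ℝ, E) ∞ M]

variable (G) in
/-- `G` preserves the symplectic form. -/
def IsSymplecticAction (Ω : SymplecticForm E M) : Prop :=
  ∀ (g : G) (x : M) (u v : TangentSpace 𝓘(ℝ, E) x),
    Ω.toFun (g • x) (mfderiv 𝓘(ℝ, E) 𝓘(ℝ, E) (fun y : M => g • y) x u)
      (mfderiv 𝓘(ℝ, E) 𝓘(ℝ, E) (fun y : M => g • y) x v) = Ω.toFun x u v

variable (E M 𝔼) in
/-- Smooth maps from `M` to the dual of the Lie algebra `T_1 G`, whose underlying vector space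
is the model space `𝔼` of `G`. -/
abbrev DualValued : Type _ :=
  C^∞⟮𝓘(ℝ, E), M; 𝓘(ℝ, 𝔼 →L[ℝ] ℝ), 𝔼 →L[ℝ] ℝ⟯

/-- The component `μ_ξ = ⟨μ, ξ⟩`. -/
def momentum (μ : DualValued E M 𝔼) (ξ : 𝔼) : SmoothFun E M :=
  ⟨fun x => μ x ξ, (ContinuousLinearMap.apply ℝ ℝ ξ).contDiff.contMDiff.comp μ.contMDiff⟩

variable (G) in
/-- Moment maps: `dμ_ξ = - ι_ξ Ω`, and `μ` is equivariant for the coadjoint action. -/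
structure IsMomentMap (Ω : SymplecticForm E M) (μ : DualValued E M 𝔼) : Prop where
  mvfderiv_eq : ∀ (ξ : LieAlg 𝔼 G) (x : M) (w : TangentSpace 𝓘(ℝ, E) x),
    mvfderiv 𝓘(ℝ, E) (momentum μ ξ) x w = - Ω.toFun x (fundamentalField ξ x) w
  equivariant : ∀ (g : G) (x : M) (ξ : LieAlg 𝔼 G), μ (g • x) ξ = μ x (Ad g⁻¹ ξ)

/-- The zero locus of `μ`. -/
def zeroLocus (μ : DualValued E M 𝔼) : Set M := {x | μ x = 0}

/-- The momentum ideal `I_μ`, generated by the functions `μ_ξ`. -/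
def momentumIdeal (μ : DualValued E M 𝔼) : Ideal (SmoothFun E M) :=
  Ideal.span (Set.range (momentum μ))

/-! ### L∞-reduction of a symplectic manifold -/

variable (𝔼 G)

/-- Reducible vector fields: tangent to `N`, and with all brackets `[v, ξ]` in
`𝔛_𝔤(M) + I_𝔛(N)`. -/
def reducibleFields (N : Set M) : Set (VField E M) :=
  {v | v ∈ tangentFields N ∧ ∀ ξ : LieAlg 𝔼 G,
    mlieBracket 𝓘(ℝ, E) v (fundamentalField ξ) ∈ fundamentalFields E M 𝔼 G + vanishingFields N}

/-- Reducible observables `L_∞(M, Ω)_[N]`: functions `f` with `ξ f ∈ I_N` for all `ξ` and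
with reducible Hamiltonian vector field. -/
def reducibleObservables (Ω : SymplecticForm E M) (N : Set M) : Set (SmoothFun E M) :=
  {f | (∀ ξ : LieAlg 𝔼 G, ∀ x ∈ N, VField.deriv (E := E) (fundamentalField ξ) f x = 0) ∧
    Ω.hamVF f ∈ reducibleFields 𝔼 G N}

/-- Vanishing observables `I_{L_∞}(N)`: reducible observables `f ∈ I_N` with
`v_f ∈ 𝔛_𝔤(M) + I_𝔛(N)`. -/
def vanishingObservables (Ω : SymplecticForm E M) (N : Set M) : Set (SmoothFun E M) :=
  {f | f ∈ reducibleObservables 𝔼 G Ω N ∧ f ∈ constraintIdeal (E := E) N ∧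
    Ω.hamVF f ∈ fundamentalFields E M 𝔼 G + vanishingFields N}

end Action

end Manifold

end

noncomputable section

/-! ### Reduction in Poisson algebras -/

namespace PoissonBracket

variable {A : Type*} [CommRing A] [Algebra ℝ A] (P : PoissonBracket A)

/-! The geometry enters only through operators on functions. The moment map condition says that the
fundamental field of `ξ` is the Hamiltonian field of `μ_ξ`, and `[v_f, v_h]` acts on functions as
`{{f, h}, ·}`. Hence a smooth vector field lies in `𝔛_𝔤(M) + I_𝔛(N)` exactly when its operator is,
modulo operators with values in `I_N`, a `C^∞(M)`-combination of the `{μ_ξ, ·}`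
(`IsMomentMap.mem_fundamentalFields_add_iff`). Both reductions thus become statements about a
Poisson algebra `A`, an ideal `I` and a family `m i`.

The algebraic core is `commutator_mem_generated`: for reducible `f`, commutation with `{f, ·}`
preserves the module `generated I m`. With the Jacobi identity this gives closure of the reducible
elements under the bracket and the Poisson ideal property. Products are handled by `{ab, ·} = a{b,
·} + b{a, ·}`, where the second term has values in `I` as soon as `b ∈ I`.

On the Dirac side, `I_N ⊆ F_N` turns `F_N ∩ I_N` into `I_N`, so that `O(N) = F_N` is the normalizer
of `I_N`. Reducible elements normalize `I_N` by definition, whence the morphism. If `I_N = I_μ + I_N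
∩ Q`, every `f ∈ I_N` has `{f, ·}` in the generated module; since a normalizing `f` sends `μ_ξ ∈
I_N` into `I_N`, the remaining reducibility conditions are automatic. -/

theorem bracket_swap (a b : A) : P.bracket a b = - P.bracket b a := by
  have h := P.bracket_self (a + b)
  simp only [map_add, LinearMap.add_apply, P.bracket_self, zero_add, add_zero] at h
  exact eq_neg_of_add_eq_zero_right h

theorem bracket_mul_left (a b c : A) :
    P.bracket (a * b) c = a * P.bracket b c + b * P.bracket a c := by
  rw [P.bracket_swap, P.leibniz, P.bracket_swap c a, P.bracket_swap c b]; ring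

theorem bracket_one (a : A) : P.bracket a 1 = 0 := by
  simpa using P.leibniz a 1 1

theorem one_bracket (a : A) : P.bracket 1 a = 0 := by
  rw [P.bracket_swap, P.bracket_one, neg_zero]

theorem algebraMap_bracket (r : ℝ) (a : A) : P.bracket (algebraMap ℝ A r) a = 0 := by
  rw [Algebra.algebraMap_eq_smul_one, map_smul, LinearMap.smul_apply, P.one_bracket, smul_zero]

theorem bracket_mul_eq (a b : A) :
    P.bracket (a * b) = a • P.bracket b + b • P.bracket a :=
  LinearMap.ext fun c => P.bracket_mul_left a b c

variable (I : Ideal A)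

/-- The linear endomorphisms with values in the ideal `I`. -/
def valuedIn : Submodule A (A →ₗ[ℝ] A) where
  carrier := {T | ∀ g, T g ∈ I}
  add_mem' hS hT g := I.add_mem (hS g) (hT g)
  zero_mem' _ := I.zero_mem
  smul_mem' a _ hT g := I.mul_mem_left a (hT g)

variable {ι : Type*} (m : ι → A)

/-- The module of endomorphisms which, modulo `I`, are combinations of the Hamiltonian derivations
of the functions `m i`. -/
def generated : Submodule A (A →ₗ[ℝ] A) :=
  Submodule.span A (Set.range fun i => P.bracket (m i)) ⊔ valuedIn I

variable {I m}

/-- The finite-sum form matches the definition of `fundamentalFields`, which is what permits the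
comparison with vector fields. -/
theorem mem_generated_iff {T : A →ₗ[ℝ] A} :
    T ∈ P.generated I m ↔ ∃ (n : ℕ) (a : Fin n → A) (i : Fin n → ι),
      ∀ g, T g - ∑ k, a k * P.bracket (m (i k)) g ∈ I := by
  rw [generated, Submodule.mem_sup]
  constructor
  · rintro ⟨S, hS, U, hU, rfl⟩
    obtain ⟨n, a, s, rfl⟩ := Submodule.mem_span_set'.1 hS
    choose i hi using fun k => (s k).2
    refine ⟨n, a, i, fun g => ?_⟩
    have : (∑ k, a k • (s k : A →ₗ[ℝ] A)) g = ∑ k, a k * P.bracket (m (i k)) g := by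
      simp [LinearMap.sum_apply, ← hi]
    rw [LinearMap.add_apply, this, add_sub_cancel_left]
    exact hU g
  · rintro ⟨n, a, i, h⟩
    refine ⟨∑ k, a k • P.bracket (m (i k)), Submodule.sum_mem _ fun k _ =>
      Submodule.smul_mem _ _ (Submodule.subset_span ⟨i k, rfl⟩),
      T - ∑ k, a k • P.bracket (m (i k)), fun g => ?_, add_sub_cancel _ _⟩
    simpa [LinearMap.sum_apply] using h g

theorem bracket_mem_generated (i : ι) : P.bracket (m i) ∈ P.generated I m :=
  Submodule.mem_sup_left (Submodule.subset_span ⟨i, rfl⟩)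

theorem smul_mem_generated {a : A} (ha : a ∈ I) (T : A →ₗ[ℝ] A) : a • T ∈ P.generated I m :=
  Submodule.mem_sup_right fun g => I.mul_mem_right (T g) ha

/-- By the Leibniz rule the only uncontrolled term is `b • {a, ·}`, and `b ∈ I` makes it `I`-valued.
Nothing is required of `a`. -/
theorem bracket_mul_mem_generated (a : A) {b : A} (hb : b ∈ I)
    (hb' : P.bracket b ∈ P.generated I m) : P.bracket (a * b) ∈ P.generated I m := by
  rw [P.bracket_mul_eq]
  exact Submodule.add_mem _ (Submodule.smul_mem _ _ hb') (P.smul_mem_generated hb _)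

/-- The Jacobi identity in operator form: `a ↦ {a, ·}` takes brackets to commutators. -/
theorem bracket_bracket_eq (a b : A) :
    P.bracket (P.bracket a b) = P.bracket a ∘ₗ P.bracket b - P.bracket b ∘ₗ P.bracket a :=
  LinearMap.ext fun c => by simp [P.jacobi a b c]

variable (I m)

/-- The normalizer `{f | {f, I} ⊆ I}` of an ideal, a subalgebra. -/
def normalizer : Subalgebra ℝ A where
  carrier := {f | ∀ h ∈ I, P.bracket f h ∈ I}
  add_mem' hf hg h hh := by
    rw [map_add]; exact I.add_mem (hf h hh) (hg h hh)
  mul_mem' {f g} hf hg h hh := by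
    rw [P.bracket_mul_left]
    exact I.add_mem (I.mul_mem_left _ (hg h hh)) (I.mul_mem_left _ (hf h hh))
  algebraMap_mem' r h _ := by
    rw [P.algebraMap_bracket]; exact I.zero_mem

/-- The subalgebra of the elements `f` of the normalizer of `I` with `{m i, f} ∈ I` and such that
`{f, m i}` generates a derivation which is, modulo `I`, a combination of those of the `m j`. -/
def reducible : Subalgebra ℝ A where
  carrier := {f | f ∈ P.normalizer I ∧ (∀ i, P.bracket (m i) f ∈ I) ∧
    ∀ i, P.bracket (P.bracket f (m i)) ∈ P.generated I m}
  add_mem' := by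
    rintro f g ⟨hf, hf', hf''⟩ ⟨hg, hg', hg''⟩
    refine ⟨add_mem hf hg, fun i => ?_, fun i => ?_⟩
    · rw [map_add]; exact I.add_mem (hf' i) (hg' i)
    · rw [map_add, LinearMap.add_apply, map_add]; exact Submodule.add_mem _ (hf'' i) (hg'' i)
  mul_mem' := by
    rintro f g ⟨hf, hf', hf''⟩ ⟨hg, hg', hg''⟩
    have neg : ∀ {f : A} {i}, P.bracket (m i) f ∈ I → P.bracket f (m i) ∈ I := fun h => by
      rw [P.bracket_swap]; exact I.neg_mem h
    refine ⟨mul_mem hf hg, fun i => ?_, fun i => ?_⟩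
    · rw [P.leibniz]
      exact I.add_mem (I.mul_mem_right _ (hf' i)) (I.mul_mem_left _ (hg' i))
    -- Here `{fg, m i} = f{g, m i} + g{f, m i}`. The condition `{m i, ·} ∈ I` on both factors puts
    -- the inner brackets in `I`, so the product rule for `generated` applies to each term.
    · rw [P.bracket_mul_left, map_add]
      exact Submodule.add_mem _ (P.bracket_mul_mem_generated f (neg (hg' i)) (hg'' i))
        (P.bracket_mul_mem_generated g (neg (hf' i)) (hf'' i))
  algebraMap_mem' r := by
    refine ⟨algebraMap_mem _ r, fun i => ?_, fun i => ?_⟩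
    · rw [P.bracket_swap, P.algebraMap_bracket, neg_zero]; exact I.zero_mem
    · rw [P.algebraMap_bracket, map_zero]; exact Submodule.zero_mem _

variable {I m}

theorem bracket_mem_normalizer {f g : A} (hf : f ∈ P.normalizer I) (hg : g ∈ P.normalizer I) :
    P.bracket f g ∈ P.normalizer I := fun h hh => by
  rw [eq_sub_of_add_eq (P.jacobi f g h).symm]
  exact I.sub_mem (hf _ (hg h hh)) (hg _ (hf h hh))

/-- Commutation with `{f, ·}` is a derivation over the module structure, so it suffices to treat
generators, where the claim is the third reducibility condition, and `I`-valued operators, where it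
follows from `{f, I} ⊆ I`. -/
theorem commutator_mem_generated {f : A} (hf : f ∈ P.reducible I m) {T : A →ₗ[ℝ] A}
    (hT : T ∈ P.generated I m) :
    P.bracket f ∘ₗ T - T ∘ₗ P.bracket f ∈ P.generated I m := by
  obtain ⟨S, hS, U, hU, rfl⟩ := Submodule.mem_sup.1 hT
  have hU' : P.bracket f ∘ₗ U - U ∘ₗ P.bracket f ∈ P.generated I m :=
    Submodule.mem_sup_right fun g => I.sub_mem (hf.1 _ (hU g)) (hU _)
  rw [LinearMap.comp_add, LinearMap.add_comp, add_sub_add_comm]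
  refine Submodule.add_mem _ ?_ hU'
  clear hT hU hU'
  induction hS using Submodule.span_induction with
  | mem T hT =>
    obtain ⟨i, rfl⟩ := hT
    rw [← P.bracket_bracket_eq]
    exact hf.2.2 i
  | zero => simp
  | add S T _ _ hS hT =>
    rw [LinearMap.comp_add, LinearMap.add_comp, add_sub_add_comm]
    exact Submodule.add_mem _ hS hT
  | smul a S hS ih =>
    -- The coefficient is differentiated as well, giving the extra term `{f, a} S`. It remains in
    -- the span because `S` does.
    have : P.bracket f ∘ₗ (a • S) - (a • S) ∘ₗ P.bracket f =
        P.bracket f a • S + a • (P.bracket f ∘ₗ S - S ∘ₗ P.bracket f) :=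
      LinearMap.ext fun g => by
        simp [P.leibniz]; ring
    rw [this]
    exact Submodule.add_mem _ (Submodule.smul_mem _ _ (Submodule.mem_sup_left hS))
      (Submodule.smul_mem _ _ ih)

theorem bracket_bracket_mem_generated {f h : A} (hf : f ∈ P.reducible I m)
    (hh : P.bracket h ∈ P.generated I m) : P.bracket (P.bracket f h) ∈ P.generated I m := by
  rw [P.bracket_bracket_eq]
  exact P.commutator_mem_generated hf hh

/-- The Jacobi identity expands `{m i, {f, g}}` and `{{f, g}, m i}` into iterated brackets with
inner bracket `{m i, ·}` or `{·, m i}`; the outer bracket by a reducible element preserves `I` and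
the generated module. -/
theorem bracket_mem_reducible {f g : A} (hf : f ∈ P.reducible I m) (hg : g ∈ P.reducible I m) :
    P.bracket f g ∈ P.reducible I m := by
  refine ⟨P.bracket_mem_normalizer hf.1 hg.1, fun i => ?_, fun i => ?_⟩
  · rw [P.jacobi, P.bracket_swap _ g]
    exact I.add_mem (I.neg_mem (hg.1 _ (hf.2.1 i))) (hf.1 _ (hg.2.1 i))
  · rw [eq_sub_of_add_eq (P.jacobi f g (m i)).symm, map_sub]
    exact Submodule.sub_mem _ (P.bracket_bracket_mem_generated hf (hg.2.2 i))
      (P.bracket_bracket_mem_generated hg (hf.2.2 i))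

variable (I m)

/-- The normalizer of `I` with the ideal of its elements in `I`. -/
def normalizerSubquotient : PoissonSubquotient P where
  subalgebra := P.normalizer I
  bracket_mem a b := P.bracket_mem_normalizer a.2 b.2
  ideal := I.comap (P.normalizer I).val
  bracket_mem_ideal a b hb := a.2 b hb

/-- The reducible elements, with the ideal of those that lie in `I` and whose derivation is,
modulo `I`, a combination of those of the `m i`. -/
def reducibleSubquotient : PoissonSubquotient P where
  subalgebra := P.reducible I m
  bracket_mem a b := P.bracket_mem_reducible a.2 b.2
  ideal :=
    { carrier := {f | (f : A) ∈ I ∧ P.bracket (f : A) ∈ P.generated I m}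
      add_mem' := fun {f g} hf hg => ⟨I.add_mem hf.1 hg.1, by
        rw [Subalgebra.coe_add, map_add]; exact Submodule.add_mem _ hf.2 hg.2⟩
      zero_mem' := ⟨I.zero_mem, by
        rw [Subalgebra.coe_zero, map_zero]; exact Submodule.zero_mem _⟩
      smul_mem' := fun a f hf => ⟨I.mul_mem_left _ hf.1,
        P.bracket_mul_mem_generated a hf.1 hf.2⟩ }
  bracket_mem_ideal a b hb := ⟨a.2.1 b hb.1, P.bracket_bracket_mem_generated a.2 hb.2⟩

variable {I m}

/-- If `I` is generated by the `m i` up to elements `q` with `{q, A} ⊆ I`, then all its elements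
generate combinations of the derivations of the `m i`. -/
theorem generated_of_ideal_subset (hm : ∀ i, m i ∈ I)
    (hI : ∀ f ∈ I, ∃ p ∈ Ideal.span (Set.range m), ∃ q, (∀ g, P.bracket q g ∈ I) ∧ p + q = f)
    {f : A} (hf : f ∈ I) : P.bracket f ∈ P.generated I m := by
  obtain ⟨p, hp, q, hq, rfl⟩ := hI f hf
  rw [map_add]
  refine Submodule.add_mem _ ?_ (Submodule.mem_sup_right hq)
  -- Needed for the multiples in the induction: the product rule requires the factor `p` to lie in
  -- `I`.
  have hspan : Ideal.span (Set.range m) ≤ I := Ideal.span_le.2 (Set.range_subset_iff.2 hm)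
  clear hf
  induction hp using Submodule.span_induction with
  | mem p hp => obtain ⟨i, rfl⟩ := hp; exact P.bracket_mem_generated i
  | zero => rw [map_zero]; exact Submodule.zero_mem _
  | add p p' _ _ h h' => rw [map_add]; exact Submodule.add_mem _ h h'
  | smul a p hp h => exact P.bracket_mul_mem_generated a (hspan hp) h

/-- A normalizing `f` takes `m i ∈ I` to `{f, m i} ∈ I`. This is the second condition up to sign,
and by `hI` it implies the third. -/
theorem reducible_eq_normalizer (hm : ∀ i, m i ∈ I)
    (hI : ∀ f ∈ I, P.bracket f ∈ P.generated I m) : P.reducible I m = P.normalizer I := by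
  refine le_antisymm (fun f hf => hf.1) fun f hf => ⟨hf, fun i => ?_, fun i => hI _ (hf _ (hm i))⟩
  rw [P.bracket_swap]
  exact I.neg_mem (hf _ (hm i))

end PoissonBracket

/-! ### Morphisms between Poisson subquotients -/

namespace PoissonSubquotient

variable {A : Type*} [CommRing A] [Algebra ℝ A] {P : PoissonBracket A}

/-- The morphism between subquotients induced by the identity on representatives. -/
def inclusionHom (S T : PoissonSubquotient P) (h : S.subalgebra ≤ T.subalgebra)
    (hI : ∀ a : S.subalgebra, a ∈ S.ideal → Subalgebra.inclusion h a ∈ T.ideal) :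
    PoissonHom S.quotBracket T.quotBracket where
  __ := Ideal.quotientMapₐ T.ideal (Subalgebra.inclusion h) hI
  map_bracket := by rintro ⟨a⟩ ⟨b⟩; rfl

theorem inclusionHom_bijective (S T : PoissonSubquotient P) (h : S.subalgebra ≤ T.subalgebra)
    (hI : ∀ a : S.subalgebra, a ∈ S.ideal → Subalgebra.inclusion h a ∈ T.ideal)
    (h' : T.subalgebra ≤ S.subalgebra)
    (hI' : ∀ a : S.subalgebra, Subalgebra.inclusion h a ∈ T.ideal → a ∈ S.ideal) :
    Function.Bijective (inclusionHom S T h hI).toAlgHom := by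
  constructor
  · rw [injective_iff_map_eq_zero]
    rintro ⟨a⟩ ha
    exact Ideal.Quotient.eq_zero_iff_mem.2 (hI' a (Ideal.Quotient.eq_zero_iff_mem.1 ha))
  · rintro ⟨b⟩
    exact ⟨S.cls ⟨b, h' b.2⟩, rfl⟩

end PoissonSubquotient

/-! ### Hamiltonian actions and the operators of vector fields along a constraint set -/

section HamiltonianActions

variable {E : Type*} [NormedAddCommGroup E] [NormedSpace ℝ E]
  {M : Type*} [TopologicalSpace M] [ChartedSpace E M] [IsManifold 𝓘(ℝ, E) ∞ M]

theorem VField.IsSmooth.sub {u v : VField E M} (hu : u.IsSmooth) (hv : v.IsSmooth) :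
    VField.IsSmooth (u - v) :=
  ContMDiff.sub_section hu hv

theorem VField.IsSmooth.sum_smul {n : ℕ} (a : Fin n → SmoothFun E M) {v : Fin n → VField E M}
    (hv : ∀ i, (v i).IsSmooth) : VField.IsSmooth (fun x => ∑ i, a i x • v i x) :=
  ContMDiff.sum_section fun i _ => ContMDiff.smul_section (a i).contMDiff (hv i)

theorem VField.IsSmooth.mlieBracket [FiniteDimensional ℝ E] {u v : VField E M} (hu : u.IsSmooth)
    (hv : v.IsSmooth) : VField.IsSmooth (mlieBracket 𝓘(ℝ, E) u v) := by
  have : CompleteSpace E := FiniteDimensional.complete ℝ E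
  have : IsManifold 𝓘(ℝ, E) (minSmoothness ℝ 2) M := by
    simp only [minSmoothness_of_isRCLikeNormedField]; infer_instance
  have : IsManifold 𝓘(ℝ, E) (((⊤ : ℕ∞) : ℕ∞ω) + 1) M := ‹IsManifold 𝓘(ℝ, E) ∞ M›
  exact fun x => ContMDiffAt.mlieBracket_vectorField (m := ⊤) (n := ⊤) (hu x) (hv x) (by simp)

variable (Ω : SymplecticForm E M)

/-- Since `I_N ⊆ F_N`, the test functions `F_N ∩ I_N` are all of `I_N`. -/
theorem diracObservables_eq {N : Set M} (hN : IsFirstClass Ω N) :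
    diracObservables Ω N = firstClassFunctions Ω N :=
  Set.ext fun _ => ⟨fun hf h hh => hf h (hN.2 hh) hh, fun hf h _ hh => hf h hh⟩

variable [FiniteDimensional ℝ E]

namespace SymplecticForm

theorem hamVF_deriv (f g : SmoothFun E M) (x : M) :
    (Ω.hamVF f).deriv g x = Ω.poissonBracket.bracket f g x :=
  (congrFun (Ω.poisson_eq_deriv f g) x).symm

/-- The action on functions is all that is needed, because `vanishingFields` tests a smooth field
only through it. -/
theorem mlieBracket_hamVF_deriv (f h g : SmoothFun E M) (x : M) :
    VField.deriv (mlieBracket 𝓘(ℝ, E) (Ω.hamVF f) (Ω.hamVF h)) g x =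
      Ω.poissonBracket.bracket (Ω.poissonBracket.bracket f h) g x := by
  rw [mlieBracket_deriv (Ω.hamVF_isSmooth f) (Ω.hamVF_isSmooth h) g.contMDiff,
    funext (Ω.hamVF_deriv h g), funext (Ω.hamVF_deriv f g), hamVF_deriv, hamVF_deriv,
    Ω.poissonBracket.jacobi, ContMDiffMap.coe_add, Pi.add_apply, add_sub_cancel_right]

end SymplecticForm

/-! ### Moment maps: translating vector fields into operators -/

variable {𝔼 : Type*} [NormedAddCommGroup 𝔼] [NormedSpace ℝ 𝔼]
  {G : Type*} [TopologicalSpace G] [ChartedSpace 𝔼 G] [Group G] [MulAction G M]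
  {Ω} {μ : DualValued E M 𝔼}

/-- Nondegeneracy of `Ω` makes the solution of `dμ_ξ = -ι_v Ω` unique. Smoothness of fundamental
fields comes with this identification. -/
theorem IsMomentMap.fundamentalField_eq (hμ : IsMomentMap G Ω μ) (ξ : LieAlg 𝔼 G) :
    (fundamentalField ξ : VField E M) = Ω.hamVF (momentum μ ξ) :=
  funext fun x => (Ω.hamVF_eq (hμ.mvfderiv_eq ξ x)).symm

/-- A smooth vector field that acts along `N` as an operator `T` lies in `𝔛_𝔤(M) + I_𝔛(N)` if and
only if `T` is, modulo `I_N`, a combination of the derivations `{μ_ξ, ·}`. -/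
theorem IsMomentMap.mem_fundamentalFields_add_iff (hμ : IsMomentMap G Ω μ) {N : Set M}
    {u : VField E M} (hu : u.IsSmooth) {T : SmoothFun E M →ₗ[ℝ] SmoothFun E M}
    (hT : ∀ g : SmoothFun E M, ∀ x ∈ N, u.deriv g x = T g x) :
    u ∈ fundamentalFields E M 𝔼 G + vanishingFields N ↔
      T ∈ Ω.poissonBracket.generated (constraintIdeal N) (momentum μ) := by
  have key : ∀ (n : ℕ) (a : Fin n → SmoothFun E M) (ξ : Fin n → 𝔼) (g : SmoothFun E M) (x : M),
      VField.deriv (fun x => ∑ i, a i x • Ω.hamVF (momentum μ (ξ i)) x) g x =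
        (∑ i, a i * Ω.poissonBracket.bracket (momentum μ (ξ i)) g) x := by
    intro n a ξ g x
    have h : ∀ s : Finset (Fin n), (∑ i ∈ s, a i * Ω.poissonBracket.bracket (momentum μ (ξ i)) g) x
        = ∑ i ∈ s, a i x * Ω.poissonBracket.bracket (momentum μ (ξ i)) g x := fun s =>
      map_sum (ContMDiffMap.evalRingHom x) _ s
    rw [h, VField.deriv, map_sum]
    refine Finset.sum_congr rfl fun i _ => ?_
    rw [map_smul, smul_eq_mul, ← Ω.hamVF_deriv]
    rfl
  have hsub : ∀ (v w : VField E M) (g : SmoothFun E M) (x : M),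
      VField.deriv (v - w) g x = v.deriv g x - w.deriv g x := fun v w g x => map_sub _ _ _
  rw [PoissonBracket.mem_generated_iff]
  constructor
  · rintro ⟨v, ⟨n, a, ξ, hv⟩, w, hw, rfl⟩
    refine ⟨n, a, ξ, fun g x hx => ?_⟩
    have hv' : v = fun x => ∑ i, a i x • Ω.hamVF (momentum μ (ξ i)) x :=
      funext fun x => by simp only [hv, hμ.fundamentalField_eq]
    have hw' : VField.deriv (v + w - v) g x = 0 := by
      rw [add_sub_cancel_left]; exact hw.2 g x hx
    rw [hsub] at hw'
    have hk : v.deriv g x = _ := hv' ▸ key n a ξ g x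
    rw [hk] at hw'
    rw [ContMDiffMap.coe_sub, Pi.sub_apply, ← hT g x hx]
    exact hw'
  · rintro ⟨n, a, ξ, h⟩
    -- The vanishing part is the difference between `u` and the combination. It is smooth since both
    -- are, and it kills functions along `N` by `h`.
    refine ⟨fun x => ∑ i, a i x • Ω.hamVF (momentum μ (ξ i)) x,
      ⟨n, a, ξ, fun x => Finset.sum_congr rfl fun i _ =>
        congrArg (a i x • ·) (congrFun (hμ.fundamentalField_eq (ξ i)) x).symm⟩, _,
      ⟨hu.sub (VField.IsSmooth.sum_smul a fun i => Ω.hamVF_isSmooth _), fun g x hx => ?_⟩,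
      add_sub_cancel _ _⟩
    rw [hsub, key, hT g x hx]
    exact h g x hx

/-- Each geometric condition is matched with its algebraic counterpart; for the bracket condition
the operator of `[v_f, ξ]` is `{{f, μ_ξ}, ·}`. -/
theorem IsMomentMap.mem_reducibleObservables (hμ : IsMomentMap G Ω μ) {N : Set M}
    {f : SmoothFun E M} : f ∈ reducibleObservables 𝔼 G Ω N ↔
      f ∈ Ω.poissonBracket.reducible (constraintIdeal N) (momentum μ) := by
  have h1 : (∀ ξ : LieAlg 𝔼 G, ∀ x ∈ N, VField.deriv (E := E) (fundamentalField ξ) f x = 0) ↔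
      ∀ ξ, Ω.poissonBracket.bracket (momentum μ ξ) f ∈ constraintIdeal (E := E) N :=
    forall_congr' fun ξ => forall₂_congr fun x _ => by
      rw [hμ.fundamentalField_eq, Ω.hamVF_deriv]
  have h2 : Ω.hamVF f ∈ tangentFields N ↔
      f ∈ Ω.poissonBracket.normalizer (constraintIdeal N) :=
    (and_iff_right (Ω.hamVF_isSmooth f)).trans
      (forall₂_congr fun g _ => forall₂_congr fun x _ => by rw [Ω.hamVF_deriv])
  have h3 : (∀ ξ : LieAlg 𝔼 G, mlieBracket 𝓘(ℝ, E) (Ω.hamVF f) (fundamentalField ξ) ∈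
        fundamentalFields E M 𝔼 G + vanishingFields N) ↔
      ∀ ξ, Ω.poissonBracket.bracket (Ω.poissonBracket.bracket f (momentum μ ξ)) ∈
        Ω.poissonBracket.generated (constraintIdeal N) (momentum μ) :=
    forall_congr' fun ξ => by
      rw [hμ.fundamentalField_eq]
      exact hμ.mem_fundamentalFields_add_iff
        ((Ω.hamVF_isSmooth f).mlieBracket (Ω.hamVF_isSmooth _))
        fun (g : SmoothFun E M) x _ => Ω.mlieBracket_hamVF_deriv f _ g x
  exact (and_congr h1 (and_congr h2 h3)).trans and_left_comm

theorem IsMomentMap.mem_vanishingObservables (hμ : IsMomentMap G Ω μ) {N : Set M}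
    {f : SmoothFun E M} : f ∈ vanishingObservables 𝔼 G Ω N ↔
      f ∈ Ω.poissonBracket.reducible (constraintIdeal N) (momentum μ) ∧
      f ∈ constraintIdeal (E := E) N ∧ Ω.poissonBracket.bracket f ∈
        Ω.poissonBracket.generated (constraintIdeal N) (momentum μ) :=
  and_congr hμ.mem_reducibleObservables <| and_congr_right fun _ =>
    hμ.mem_fundamentalFields_add_iff (Ω.hamVF_isSmooth f) fun g x _ => Ω.hamVF_deriv f g x

end HamiltonianActions

end

/-! ### Assembly of the two reductions and their comparison -/

theorem mainTheorem9 {E : Type*} [NormedAddCommGroup E] [NormedSpace ℝ E] [FiniteDimensional ℝ E]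
    {M : Type*} [TopologicalSpace M] [T2Space M] [ParacompactSpace M] [ChartedSpace E M]
    [IsManifold 𝓘(ℝ, E) ∞ M]
    {𝔼 : Type*} [NormedAddCommGroup 𝔼] [NormedSpace ℝ 𝔼] [FiniteDimensional ℝ 𝔼]
    {G : Type*} [TopologicalSpace G] [ChartedSpace 𝔼 G] [Group G] [LieGroup 𝓘(ℝ, 𝔼) ∞ G]
    [MulAction G M] [ContMDiffSMul 𝓘(ℝ, 𝔼) 𝓘(ℝ, E) ∞ G M]
    (Ω : SymplecticForm E M) (hΩ : IsSymplecticAction G Ω)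
    (μ : DualValued E M 𝔼) (hμ : IsMomentMap G Ω μ)
    (N : Set M) (hNμ : N = zeroLocus μ) (hN : IsFirstClass Ω N) :
    -- the L∞-reduction and the Dirac reduction are well defined Poisson subquotients of `C^∞(M)`
    ∃ L D : PoissonSubquotient Ω.poissonBracket,
      (L.subalgebra : Set (SmoothFun E M)) = reducibleObservables 𝔼 G Ω N ∧
      (∀ f : L.subalgebra, f ∈ L.ideal ↔ (f : SmoothFun E M) ∈ vanishingObservables 𝔼 G Ω N) ∧
      (D.subalgebra : Set (SmoothFun E M)) = diracObservables Ω N ∧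
      diracObservables Ω N = firstClassFunctions Ω N ∧
      (∀ f : D.subalgebra, f ∈ D.ideal ↔ (f : SmoothFun E M) ∈ constraintIdeal (E := E) N) ∧
    -- the identity on representatives induces a Poisson morphism between them
    ∃ Φ : PoissonHom L.quotBracket D.quotBracket,
      (∀ (f : SmoothFun E M) (hL : f ∈ L.subalgebra),
        ∃ hD : f ∈ D.subalgebra, Φ.toAlgHom (L.cls ⟨f, hL⟩) = D.cls ⟨f, hD⟩) ∧
      ((constraintIdeal (E := E) N : Set (SmoothFun E M)) =
          (momentumIdeal μ : Set (SmoothFun E M)) +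
            ((constraintIdeal (E := E) N : Set (SmoothFun E M)) ∩ casimirFunctions Ω N) →
        reducibleObservables 𝔼 G Ω N = diracObservables Ω N ∧
        vanishingObservables 𝔼 G Ω N = (constraintIdeal (E := E) N : Set (SmoothFun E M)) ∧
        Function.Bijective Φ.toAlgHom) := by
  let P := Ω.poissonBracket
  let I := constraintIdeal (E := E) N
  let m : 𝔼 → SmoothFun E M := momentum μ
  have hm : ∀ ξ, m ξ ∈ I := fun ξ x hx => by
    rw [hNμ] at hx
    exact DFunLike.congr_fun (show μ x = 0 from hx) ξ
  have hle : (P.reducibleSubquotient I m).subalgebra ≤ (P.normalizerSubquotient I).subalgebra :=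
    fun f hf => hf.1
  refine ⟨P.reducibleSubquotient I m, P.normalizerSubquotient I,
    Set.ext fun f => hμ.mem_reducibleObservables.symm,
    fun f => ⟨fun hf => hμ.mem_vanishingObservables.2 ⟨f.2, hf⟩,
      fun hf => (hμ.mem_vanishingObservables.1 hf).2⟩,
    (diracObservables_eq Ω hN).symm, diracObservables_eq Ω hN, fun _ => Iff.rfl,
    PoissonSubquotient.inclusionHom _ _ hle fun a ha => ha.1,
    fun f hL => ⟨hle hL, rfl⟩, fun hI => ?_⟩
  -- A Casimir summand has an `I`-valued operator, so only the part in the momentum ideal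
  -- contributes derivations `{μ_ξ, ·}`.
  have hgen : ∀ f ∈ I, P.bracket f ∈ P.generated I m := fun f hf => by
    refine P.generated_of_ideal_subset hm (fun f hf => ?_) hf
    obtain ⟨p, hp, q, hq, rfl⟩ := hI.subset hf
    exact ⟨p, hp, q, hq.2, rfl⟩
  have hred : P.reducible I m = P.normalizer I := P.reducible_eq_normalizer hm hgen
  refine ⟨?_, ?_, PoissonSubquotient.inclusionHom_bijective _ _ _ _ hred.ge
    fun a ha => ⟨ha, hgen _ ha⟩⟩
  · rw [diracObservables_eq Ω hN]
    exact Set.ext fun f => hμ.mem_reducibleObservables.trans (SetLike.ext_iff.1 hred f)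
  · refine Set.ext fun f => hμ.mem_vanishingObservables.trans
      ⟨fun hf => hf.2.1, fun hf => ⟨?_, hf, hgen f hf⟩⟩
    -- Reducibility is now the same as normalizing `I`, and every `f ∈ I_N` does so because `N` is
    -- first class.
    change f ∈ P.reducible I m
    rw [hred]
    exact hN.2 hf
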